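/- Let $K>0$ be a real number and let $$Y_I(1,1,1;K)=\{(W,Z)\in\mathbb C^2 : |W|^{2K}+|Z|^2<1\}.$$ For a bounded domain $D\subset\mathbb C^2$ let $A^2(D)$ be the space of holomorphic functions on $D$ that are square integrable with respect to Lebesgue measure $dV$. The Bergman kernel function of $D$ is the unique function $B_D:D\times D\to\mathbb C$ such that, for every $w\in D$, $B_D(\cdot,w)\in A^2(D)$ and $f(w)=\int_D f(z)\,\overline{B_D(z,w)}\,dV(z)$ for all $f\in A^2(D)$. A bounded domain $D$ is called a Lu Qi-Keng domain if $B_D(z,w)\neq 0$ for all $z,w\in D$. Then the Bergman kernel function of $Y_I(1,1,1;K)$ is zero-free: $B_{Y_I(1,1,1;K)}(p,q)\ne 0$ for all $p,q\in Y_I(1,1,1;K)$. That is, $Y_I(1,1,1;K)$ is a Lu Qi-Keng domain. -/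

import Mathlib

open MeasureTheory ComplexConjugate

/-- The functions `E → ℂ` whose restriction to `D` lies in the Bergman space `A²(D)`: holomorphic
on `D` and square integrable on `D` with respect to Lebesgue measure. Values outside `D` are
irrelevant. -/
def bergmanSpace {E : Type*} [NormedAddCommGroup E] [NormedSpace ℂ E] [MeasureSpace E]
    (D : Set E) : Set (E → ℂ) :=
  {f | DifferentiableOn ℂ f D ∧ MemLp f 2 (volume.restrict D)}

/-- `B` is a reproducing kernel of `A²(D)`: for each `w ∈ D` the function `B(·, w)` belongs to
`A²(D)`, and `f(w) = ∫_D f(z) conj(B(z, w)) dV(z)` for all `f ∈ A²(D)`. -/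
def IsBergmanKernel {E : Type*} [NormedAddCommGroup E] [NormedSpace ℂ E] [MeasureSpace E]
    (D : Set E) (B : E → E → ℂ) : Prop :=
  ∀ w ∈ D, (fun z => B z w) ∈ bergmanSpace D ∧
    ∀ f ∈ bergmanSpace D, f w = ∫ z in D, f z * conj (B z w)

/-- On an open set the reproducing kernel is unique, so it is legitimate to speak of
*the* Bergman kernel. -/
theorem IsBergmanKernel.unique {E : Type*} [NormedAddCommGroup E] [NormedSpace ℂ E]
    [MeasureSpace E] [OpensMeasurableSpace E] [(volume : Measure E).IsOpenPosMeasure]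
    {D : Set E} (hD : IsOpen D) {B₁ B₂ : E → E → ℂ}
    (h₁ : IsBergmanKernel D B₁) (h₂ : IsBergmanKernel D B₂) {z w : E} (hz : z ∈ D) (hw : w ∈ D) :
    B₁ z w = B₂ z w := by
  obtain ⟨⟨d₁, m₁⟩, r₁⟩ := h₁ w hw
  obtain ⟨⟨d₂, m₂⟩, r₂⟩ := h₂ w hw
  have m : MemLp (fun z => B₁ z w - B₂ z w) 2 (volume.restrict D) := m₁.sub m₂
  have hg : (fun z => B₁ z w - B₂ z w) ∈ bergmanSpace D := ⟨d₁.sub d₂, m⟩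
  have i₁ : Integrable (fun z => (B₁ z w - B₂ z w) * conj (B₁ z w)) (volume.restrict D) :=
    m.integrable_mul m₁.star
  have i₂ : Integrable (fun z => (B₁ z w - B₂ z w) * conj (B₂ z w)) (volume.restrict D) :=
    m.integrable_mul m₂.star
  have h0 : ∫ z in D, (((‖B₁ z w - B₂ z w‖ ^ 2 : ℝ)) : ℂ) = 0 := by
    have e : ∀ z, (((‖B₁ z w - B₂ z w‖ ^ 2 : ℝ)) : ℂ) =
        (B₁ z w - B₂ z w) * conj (B₁ z w) - (B₁ z w - B₂ z w) * conj (B₂ z w) := by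
      intro z
      rw [← mul_sub, ← map_sub, Complex.mul_conj, Complex.normSq_eq_norm_sq]
    simp_rw [e]
    rw [integral_sub i₁ i₂, ← r₁ _ hg, ← r₂ _ hg, sub_self]
  rw [integral_complex_ofReal, Complex.ofReal_eq_zero,
    integral_eq_zero_iff_of_nonneg (fun _ => by positivity) m.norm.integrable_sq] at h0
  have hae : (fun z => B₁ z w) =ᵐ[volume.restrict D] (fun z => B₂ z w) := by
    filter_upwards [h0] with z hz
    simpa [sub_eq_zero] using hz
  exact Measure.eqOn_open_of_ae_eq hae hD d₁.continuousOn d₂.continuousOn hz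

open Classical in
/-- The Bergman kernel function of `D`: the reproducing kernel of `A²(D)`
(with value `0` everywhere if there is none). -/
noncomputable def bergmanKernel {E : Type*} [NormedAddCommGroup E] [NormedSpace ℂ E]
    [MeasureSpace E] (D : Set E) : E → E → ℂ :=
  if h : ∃ B, IsBergmanKernel D B then h.choose else 0

/-- A Lu Qi-Keng domain: a bounded domain whose Bergman kernel function exists and
has no zeros. -/
structure IsLuQiKengDomain {E : Type*} [NormedAddCommGroup E] [NormedSpace ℂ E]
    [MeasureSpace E] (D : Set E) : Prop where
  isOpen : IsOpen D
  isConnected : IsConnected D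
  isBounded : Bornology.IsBounded D
  isBergmanKernel : IsBergmanKernel D (bergmanKernel D)
  zero_free : ∀ z ∈ D, ∀ w ∈ D, bergmanKernel D z w ≠ 0

/-- The Cartan-Hartogs domain `Y_I(1,1,1;K)` in `ℂ²`, with coordinates `p = (W, Z)`. -/
def cartanHartogsY (K : ℝ) : Set (ℂ × ℂ) :=
  {p | ‖p.1‖ ^ (2 * K) + ‖p.2‖ ^ 2 < 1}

/-! The domain is invariant under independent rotations of `W` and `Z`, so the monomials `W ^ j * Z
^ m` are orthogonal, and averaging over rotations shows that pairing a holomorphic `f` with a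
monomial returns its Taylor coefficient times the squared norm of that monomial
(`setIntegral_mul_conj_monomial`). The kernel is therefore the sum of the monomials in `x = W * conj
W'` and `y = Z * conj Z'`, each divided by its squared norm.

With `a = (j + 1) / K`, polar coordinates give `π ^ 2 / ((j + 1) * (a + 1) * multichoose (a + 2) m)`
for that norm. The sum over `m` is a binomial series in `y`; the sum over `j` is then a combination
of derivatives of the geometric series in `t = x / (1 - y) ^ (1 / K)`. The kernel is a nonvanishing
factor times `((1 + 1 / K) - (1 - 1 / K) * t) / (1 - t) ^ 3`. On the domain `‖t‖ < 1`
(`exists_norm_le_mul_rpow`), and `|1 - 1 / K| < 1 + 1 / K`, so there is no zero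
(`cartanHartogsSum_ne_zero`).

To see that the series reproduces every `f` in `A²`, it is integrated term by term
(`isBergmanKernel_cartanHartogsKernel`). Its coefficients are positive, so its absolute sums are
values of the same closed form at the moduli, bounded for fixed `w`. Uniqueness of the kernel
transfers the conclusion to `bergmanKernel`. -/

/-! ### Taylor coefficients as circle averages -/

/-- The `n`-th Taylor coefficient of `g` at the origin. -/
noncomputable def taylorCoeff (g : ℂ → ℂ) (n : ℕ) : ℂ := (n.factorial : ℂ)⁻¹ * iteratedDeriv n g 0

theorem hasSum_taylorCoeff {R : ℝ} {g : ℂ → ℂ} (hg : DifferentiableOn ℂ g (Metric.ball 0 R))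
    {z : ℂ} (hz : ‖z‖ < R) : HasSum (fun n => taylorCoeff g n * z ^ n) (g z) := by
  have h := Complex.hasSum_taylorSeries_on_ball hg (z := z) (by simpa using hz)
  refine h.congr_fun ?_
  intro n
  simp [taylorCoeff]
  ring

theorem integral_exp_int_mul_I (n : ℤ) :
    ∫ θ in (0 : ℝ)..2 * Real.pi, Complex.exp (n * (θ * Complex.I)) =
      if n = 0 then (2 * Real.pi : ℂ) else 0 := by
  split_ifs with h
  · simp [h]
  · have hn : (n : ℂ) * Complex.I ≠ 0 := by simp [h]
    have := integral_exp_mul_complex (a := 0) (b := 2 * Real.pi) hn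
    have e : ∀ θ : ℝ, (n : ℂ) * (θ * Complex.I) = n * Complex.I * θ := fun θ => by ring
    simp_rw [e]
    rw [this]
    have e2 : (n : ℂ) * Complex.I * ((2 * Real.pi : ℝ) : ℂ) = n * (2 * Real.pi * Complex.I) := by
      push_cast; ring
    rw [e2, Complex.exp_int_mul_two_pi_mul_I]
    simp

/-- Cauchy's coefficient formula in Fourier form: in the Taylor series along the circle through `z`,
only the `j`-th mode survives integration. The factor `z ^ j` is kept on the right, so `z = 0` needs
no separate treatment. -/
theorem integral_circle_taylorCoeff {R : ℝ} {g : ℂ → ℂ}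
    (hg : DifferentiableOn ℂ g (Metric.ball 0 R)) {z : ℂ} (hz : ‖z‖ < R) (j : ℕ) :
    ∫ θ in (0 : ℝ)..2 * Real.pi,
      g (Complex.exp (θ * Complex.I) * z) * Complex.exp (-(j * (θ * Complex.I))) =
      2 * Real.pi * (taylorCoeff g j * z ^ j) := by
  have hs : ∀ θ : ℝ, HasSum (fun n : ℕ => taylorCoeff g n * z ^ n *
      Complex.exp (((n - j : ℤ) : ℂ) * (θ * Complex.I)))
      (g (Complex.exp (θ * Complex.I) * z) * Complex.exp (-(j * (θ * Complex.I)))) := by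
    intro θ
    have h := (hasSum_taylorCoeff hg (z := Complex.exp (θ * Complex.I) * z)
      (by simpa [Complex.norm_exp_ofReal_mul_I] using hz)).mul_right
        (Complex.exp (-(j * (θ * Complex.I))))
    refine h.congr_fun ?_
    intro n
    rw [mul_pow, ← Complex.exp_nat_mul]
    push_cast
    rw [sub_mul, sub_eq_add_neg, Complex.exp_add]
    ring
  have h1 := intervalIntegral.hasSum_integral_of_dominated_convergence (μ := volume)
    (a := 0) (b := 2 * Real.pi)
    (F := fun (n : ℕ) (θ : ℝ) => taylorCoeff g n * z ^ n *
      Complex.exp (((n - j : ℤ) : ℂ) * (θ * Complex.I)))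
    (bound := fun n _ => ‖taylorCoeff g n * z ^ n‖)
    (fun n => by fun_prop)
    (fun n => Filter.Eventually.of_forall fun θ _ => by
      rw [norm_mul, ← mul_assoc, ← Complex.ofReal_intCast, ← Complex.ofReal_mul,
        Complex.norm_exp_ofReal_mul_I, mul_one])
    (Filter.Eventually.of_forall fun θ _ => (hasSum_taylorCoeff hg hz).summable.norm)
    (by simp)
    (Filter.Eventually.of_forall fun θ _ => hs θ)
  simp_rw [intervalIntegral.integral_const_mul, integral_exp_int_mul_I] at h1
  refine h1.unique ?_
  have h2 := hasSum_single (f := fun n : ℕ => taylorCoeff g n * z ^ n *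
    if (n : ℤ) - j = 0 then (2 * Real.pi : ℂ) else 0) j fun n hn => by
      have : (n : ℤ) - j ≠ 0 := by omega
      simp [this]
  rwa [if_pos (sub_self _), mul_comm (taylorCoeff g j * z ^ j)] at h2

/-- On a product of a circle and a disc, the Taylor coefficients in the first variable of a
holomorphic function depend holomorphically on the second one. -/
theorem differentiableOn_taylorCoeff_of_circle {s s' ρ R : ℝ} {f : ℂ × ℂ → ℂ} (hρ : 0 < ρ)
    (hρR : ρ < R) (hs : 0 < s) (hss : s < s')
    (hf : DifferentiableOn ℂ f (Metric.ball 0 R ×ˢ Metric.ball 0 s')) (j : ℕ) :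
    DifferentiableOn ℂ (fun Z => taylorCoeff (fun W => f (W, Z)) j) (Metric.ball 0 s) := by
  have hfW : ∀ Z : ℂ, ‖Z‖ < s' → DifferentiableOn ℂ (fun W => f (W, Z)) (Metric.ball 0 R) :=
    fun Z hZ => hf.comp (by fun_prop) fun W hW => ⟨hW, by simpa using hZ⟩
  have hfZ : ∀ W : ℂ, ‖W‖ < R → DifferentiableOn ℂ (fun Z => f (W, Z)) (Metric.ball 0 s') :=
    fun W hW => hf.comp (by fun_prop) fun Z hZ => ⟨by simpa using hW, hZ⟩
  have hρn : ∀ θ : ℝ, ‖Complex.exp (θ * Complex.I) * (ρ : ℂ)‖ = ρ := fun θ => by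
    simp [Complex.norm_exp_ofReal_mul_I, abs_of_pos hρ]
  have hsn : ∀ θ : ℝ, ‖Complex.exp (θ * Complex.I) * (s : ℂ)‖ = s := fun θ => by
    simp [Complex.norm_exp_ofReal_mul_I, abs_of_pos hs]
  obtain ⟨M, hM⟩ : ∃ M, ∀ p ∈ Metric.closedBall (0 : ℂ) ρ ×ˢ Metric.closedBall (0 : ℂ) s,
      ‖f p‖ ≤ M := by
    refine ((isCompact_closedBall _ _).prod (isCompact_closedBall _ _)).exists_bound_of_continuousOn
      (hf.continuousOn.mono ?_)
    exact Set.prod_mono (Metric.closedBall_subset_ball hρR) (Metric.closedBall_subset_ball hss)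
  have hM' : ∀ θ φ : ℝ, ‖f (Complex.exp (θ * Complex.I) * ρ, Complex.exp (φ * Complex.I) * s)‖ ≤ M :=
    fun θ φ => hM _ ⟨by rw [mem_closedBall_zero_iff, hρn], by rw [mem_closedBall_zero_iff, hsn]⟩
  have hcont : Continuous fun q : ℝ × ℝ =>
      f (Complex.exp (q.1 * Complex.I) * ρ, Complex.exp (q.2 * Complex.I) * s) := by
    refine hf.continuousOn.comp_continuous (by fun_prop) fun q => ⟨?_, ?_⟩
    · rw [mem_ball_zero_iff, hρn]; exact hρR
    · rw [mem_ball_zero_iff, hsn]; exact hss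
  set h : ℕ → ℝ → ℂ := fun m θ =>
    taylorCoeff (fun Z => f (Complex.exp (θ * Complex.I) * ρ, Z)) m with hh
  have hint : ∀ m θ, 2 * Real.pi * (h m θ * s ^ m) = ∫ φ in (0 : ℝ)..2 * Real.pi,
      f (Complex.exp (θ * Complex.I) * ρ, Complex.exp (φ * Complex.I) * s) *
        Complex.exp (-(m * (φ * Complex.I))) := fun m θ =>
    (integral_circle_taylorCoeff (hfZ _ (by rw [hρn]; exact hρR)) (z := (s : ℂ))
      (by simpa [abs_of_pos hs] using hss) m).symm
  have hsC : (s : ℂ) ≠ 0 := by exact_mod_cast hs.ne'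
  have hpi : (2 * Real.pi : ℂ) ≠ 0 := by simp [Real.pi_ne_zero]
  have hhc : ∀ m, Continuous (h m) := by
    intro m
    have e : h m = fun θ : ℝ => (2 * Real.pi * (s : ℂ) ^ m)⁻¹ * ∫ φ in (0 : ℝ)..2 * Real.pi,
      f (Complex.exp (θ * Complex.I) * ρ, Complex.exp (φ * Complex.I) * s) *
        Complex.exp (-(m * (φ * Complex.I))) := by
      funext θ
      rw [← hint]
      field_simp
    rw [e]
    refine continuous_const.mul ?_
    apply intervalIntegral.continuous_parametric_intervalIntegral_of_continuous'
    exact hcont.mul (by fun_prop)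
  -- Cauchy's estimate on the circle of radius `s`, uniform in `θ`.
  have hhb : ∀ m θ, ‖h m θ‖ * s ^ m ≤ M := by
    intro m θ
    have h1 : ‖2 * Real.pi * (h m θ * s ^ m)‖ ≤ M * |2 * Real.pi - 0| := by
      rw [hint]
      refine intervalIntegral.norm_integral_le_of_norm_le_const fun φ _ => ?_
      rw [norm_mul, ← mul_assoc, ← neg_mul, ← Complex.ofReal_natCast, ← Complex.ofReal_mul,
        ← Complex.ofReal_neg, Complex.norm_exp_ofReal_mul_I, mul_one]
      exact hM' θ φ
    rw [sub_zero, norm_mul, norm_mul, norm_mul, norm_pow, Complex.norm_real, Complex.norm_real,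
      abs_of_pos (by positivity : 0 < 2 * Real.pi), Real.norm_of_nonneg Real.pi_pos.le,
      Real.norm_of_nonneg hs.le] at h1
    have := Real.pi_pos
    rw [Complex.norm_ofNat] at h1
    nlinarith
  set α : ℕ → ℂ := fun m => ∫ θ in (0 : ℝ)..2 * Real.pi,
    h m θ * Complex.exp (-(j * (θ * Complex.I))) with hα
  have hαb : ∀ m, ‖α m‖ * s ^ m ≤ M * (2 * Real.pi) := by
    intro m
    have h1 : ‖α m‖ ≤ M / s ^ m * |2 * Real.pi - 0| := by
      refine intervalIntegral.norm_integral_le_of_norm_le_const fun φ _ => ?_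
      rw [norm_mul, ← mul_assoc, ← neg_mul, ← Complex.ofReal_natCast, ← Complex.ofReal_mul,
        ← Complex.ofReal_neg, Complex.norm_exp_ofReal_mul_I, mul_one, le_div_iff₀ (by positivity)]
      exact hhb m φ
    rw [sub_zero, abs_of_pos (by positivity : 0 < 2 * Real.pi)] at h1
    calc ‖α m‖ * s ^ m ≤ M / s ^ m * (2 * Real.pi) * s ^ m := by gcongr
      _ = _ := by field_simp
  -- Expanding `f` in `Z` inside the circle integral over `W` exhibits the `j`-th coefficient, up to
  -- a constant, as a power series in `Z`.
  have key : ∀ Z : ℂ, ‖Z‖ < s → HasSum (fun m => α m * Z ^ m)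
      (2 * Real.pi * (taylorCoeff (fun W => f (W, Z)) j * ρ ^ j)) := by
    intro Z hZ
    rw [← integral_circle_taylorCoeff (hfW Z (hZ.trans hss)) (z := (ρ : ℂ))
      (by simpa [abs_of_pos hρ] using hρR) j]
    have := intervalIntegral.hasSum_integral_of_dominated_convergence (μ := volume)
      (a := 0) (b := 2 * Real.pi)
      (F := fun (m : ℕ) (θ : ℝ) => h m θ * Complex.exp (-(j * (θ * Complex.I))) * Z ^ m)
      (f := fun θ => f (Complex.exp (θ * Complex.I) * ρ, Z) * Complex.exp (-(j * (θ * Complex.I))))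
      (bound := fun m _ => M * (‖Z‖ / s) ^ m)
      (fun m => by
        have := hhc m
        exact Continuous.aestronglyMeasurable (by fun_prop))
      (fun m => Filter.Eventually.of_forall fun θ _ => by
        rw [norm_mul, norm_mul, ← mul_assoc, ← neg_mul, ← Complex.ofReal_natCast,
          ← Complex.ofReal_mul, ← Complex.ofReal_neg, Complex.norm_exp_ofReal_mul_I, mul_one,
          norm_pow, div_pow, mul_div_assoc', le_div_iff₀ (by positivity), mul_right_comm]
        gcongr
        exact hhb m θ)
      (Filter.Eventually.of_forall fun θ _ => (summable_geometric_of_lt_one (by positivity)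
        ((div_lt_one hs).2 hZ)).mul_left M)
      (by simp)
      (Filter.Eventually.of_forall fun θ _ => by
        have := (hasSum_taylorCoeff (hfZ (Complex.exp (θ * Complex.I) * ρ)
          (by rw [hρn]; exact hρR)) (z := Z) (hZ.trans hss)).mul_right
            (Complex.exp (-(j * (θ * Complex.I))))
        refine this.congr_fun ?_
        intro m
        simp only [hh]
        ring)
    simpa only [intervalIntegral.integral_mul_const] using this
  have hρC : (ρ : ℂ) ≠ 0 := by exact_mod_cast hρ.ne'
  intro Z₀ hZ₀
  rw [mem_ball_zero_iff] at hZ₀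
  -- The room between `r` and `s` provides the geometric majorant of ratio `r / s`.
  obtain ⟨r, hr, hrs⟩ := exists_between hZ₀
  have hr0 : 0 ≤ r := (norm_nonneg _).trans hr.le
  have hd : DifferentiableOn ℂ (fun Z => ∑' m, α m * Z ^ m) (Metric.ball 0 r) := by
    refine Complex.differentiableOn_tsum_of_summable_norm (u := fun m => M * (2 * Real.pi) * (r / s) ^ m)
      ((summable_geometric_of_lt_one (by positivity) ((div_lt_one hs).2 hrs)).mul_left _)
      (fun m => by fun_prop) Metric.isOpen_ball ?_
    intro m Z hZ
    rw [mem_ball_zero_iff] at hZ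
    rw [norm_mul, norm_pow, div_pow, mul_div_assoc', le_div_iff₀ (by positivity), mul_right_comm]
    exact mul_le_mul (hαb m) (pow_le_pow_left₀ (norm_nonneg _) hZ.le m) (by positivity)
      ((by positivity : 0 ≤ ‖α m‖ * s ^ m).trans (hαb m))
  have hnhds : Metric.ball (0 : ℂ) r ∈ nhds Z₀ :=
    Metric.isOpen_ball.mem_nhds (by simpa using hr)
  have h2 : DifferentiableAt ℂ (fun Z => (2 * Real.pi * (ρ : ℂ) ^ j)⁻¹ * ∑' m, α m * Z ^ m) Z₀ :=
    (hd.differentiableAt hnhds).const_mul _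
  refine (h2.congr_of_eventuallyEq ?_).differentiableWithinAt
  filter_upwards [hnhds] with Z hZ
  rw [mem_ball_zero_iff] at hZ
  rw [(key Z (hZ.trans hrs)).tsum_eq]
  field_simp

/-! ### Geometry of the domain -/

theorem cartanHartogsY_norm_snd_lt_one {K : ℝ} {p : ℂ × ℂ} (hp : p ∈ cartanHartogsY K) :
    ‖p.2‖ < 1 := by
  have h : ‖p.1‖ ^ (2 * K) + ‖p.2‖ ^ 2 < 1 := hp
  have : 0 ≤ ‖p.1‖ ^ (2 * K) := by positivity
  nlinarith [norm_nonneg p.2]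

theorem cartanHartogsY_mem_iff {K : ℝ} (hK : 0 < K) {p : ℂ × ℂ} :
    p ∈ cartanHartogsY K ↔ ‖p.2‖ < 1 ∧ ‖p.1‖ < (1 - ‖p.2‖ ^ 2) ^ (2 * K)⁻¹ := by
  have h1 : ‖p.2‖ < 1 → 0 ≤ 1 - ‖p.2‖ ^ 2 := fun h => by nlinarith [norm_nonneg p.2]
  constructor
  · intro hp
    have h2 := cartanHartogsY_norm_snd_lt_one hp
    refine ⟨h2, ?_⟩
    rw [Real.lt_rpow_inv_iff_of_pos (norm_nonneg _) (h1 h2) (by positivity)]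
    have h : ‖p.1‖ ^ (2 * K) + ‖p.2‖ ^ 2 < 1 := hp
    linarith
  · rintro ⟨h2, h3⟩
    rw [Real.lt_rpow_inv_iff_of_pos (norm_nonneg _) (h1 h2) (by positivity)] at h3
    change ‖p.1‖ ^ (2 * K) + ‖p.2‖ ^ 2 < 1
    linarith

theorem cartanHartogsY_mem_of_norm_le {K : ℝ} (hK : 0 < K) {p q : ℂ × ℂ}
    (hp : p ∈ cartanHartogsY K) (h1 : ‖q.1‖ ≤ ‖p.1‖) (h2 : ‖q.2‖ ≤ ‖p.2‖) :
    q ∈ cartanHartogsY K := by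
  have h : ‖p.1‖ ^ (2 * K) + ‖p.2‖ ^ 2 < 1 := hp
  change ‖q.1‖ ^ (2 * K) + ‖q.2‖ ^ 2 < 1
  refine lt_of_le_of_lt ?_ h
  gcongr

theorem cartanHartogsY_norm_fst_lt_one {K : ℝ} (hK : 0 < K) {p : ℂ × ℂ}
    (hp : p ∈ cartanHartogsY K) : ‖p.1‖ < 1 := by
  have h : ‖p.1‖ ^ (2 * K) + ‖p.2‖ ^ 2 < 1 := hp
  by_contra! h1
  have := Real.one_le_rpow h1 (by positivity : 0 ≤ 2 * K)
  nlinarith [sq_nonneg ‖p.2‖]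

theorem isOpen_cartanHartogsY {K : ℝ} (hK : 0 < K) : IsOpen (cartanHartogsY K) :=
  isOpen_lt ((continuous_fst.norm.rpow_const fun _ => Or.inr (by positivity)).add
    (continuous_snd.norm.pow 2)) continuous_const

theorem isBounded_cartanHartogsY {K : ℝ} (hK : 0 < K) :
    Bornology.IsBounded (cartanHartogsY K) := by
  refine (Metric.isBounded_ball (x := (0 : ℂ × ℂ)) (r := 1)).subset fun p hp => ?_
  rw [mem_ball_zero_iff, Prod.norm_def]
  exact max_lt (cartanHartogsY_norm_fst_lt_one hK hp) (cartanHartogsY_norm_snd_lt_one hp)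

theorem zero_mem_cartanHartogsY {K : ℝ} (hK : 0 < K) : (0 : ℂ × ℂ) ∈ cartanHartogsY K := by
  change ‖(0 : ℂ)‖ ^ (2 * K) + ‖(0 : ℂ)‖ ^ 2 < 1
  simp [Real.zero_rpow (by positivity : 2 * K ≠ 0)]

theorem isConnected_cartanHartogsY {K : ℝ} (hK : 0 < K) : IsConnected (cartanHartogsY K) := by
  have hs : StarConvex ℝ 0 (cartanHartogsY K) := by
    rw [starConvex_zero_iff]
    intro p hp a ha0 ha1
    refine cartanHartogsY_mem_of_norm_le hK hp ?_ ?_ <;>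
    · simp only [Prod.smul_fst, Prod.smul_snd, norm_smul, Real.norm_of_nonneg ha0]
      exact mul_le_of_le_one_left (norm_nonneg _) ha1
  exact (hs.isPathConnected (zero_mem_cartanHartogsY hK)).isConnected

/-! ### Iterated Taylor expansion on the domain -/

/-- The coefficient of `W ^ j * Z ^ m` in the Taylor expansion of `f` at the origin. -/
noncomputable def taylorCoeff₂ (f : ℂ × ℂ → ℂ) (j m : ℕ) : ℂ :=
  taylorCoeff (fun Z => taylorCoeff (fun W => f (W, Z)) j) m

theorem differentiableOn_slice {K : ℝ} (hK : 0 < K) {f : ℂ × ℂ → ℂ}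
    (hf : DifferentiableOn ℂ f (cartanHartogsY K)) {Z : ℂ} (hZ : ‖Z‖ < 1) :
    DifferentiableOn ℂ (fun W => f (W, Z)) (Metric.ball 0 ((1 - ‖Z‖ ^ 2) ^ (2 * K)⁻¹)) :=
  hf.comp (by fun_prop) fun W hW => (cartanHartogsY_mem_iff hK).2 ⟨hZ, by simpa using hW⟩

theorem differentiableOn_taylorCoeff_slice {K : ℝ} (hK : 0 < K) {f : ℂ × ℂ → ℂ}
    (hf : DifferentiableOn ℂ f (cartanHartogsY K)) (j : ℕ) :
    DifferentiableOn ℂ (fun Z => taylorCoeff (fun W => f (W, Z)) j) (Metric.ball 0 1) := by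
  intro Z₀ hZ₀
  rw [mem_ball_zero_iff] at hZ₀
  obtain ⟨s, hs, hs1⟩ := exists_between hZ₀
  obtain ⟨s', hss', hs'1⟩ := exists_between hs1
  have hs0 : 0 < s := (norm_nonneg _).trans_lt hs
  -- The slice radius decreases in `‖Z‖`, so its value at `s'` serves for all `‖Z‖ < s'` and gives a
  -- product of discs inside the domain.
  have hR : 0 < (1 - s' ^ 2) ^ (2 * K)⁻¹ := Real.rpow_pos_of_pos (by nlinarith) _
  have h := differentiableOn_taylorCoeff_of_circle (half_pos hR) (half_lt_self hR) hs0 hss'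
    (hf.mono (by
      rintro p ⟨hp1, hp2⟩
      rw [mem_ball_zero_iff] at hp1 hp2
      refine (cartanHartogsY_mem_iff hK).2 ⟨hp2.trans hs'1, hp1.trans_le ?_⟩
      refine Real.rpow_le_rpow (by nlinarith) ?_ (by positivity)
      have := norm_nonneg p.2
      nlinarith)) j
  exact (h.differentiableAt (Metric.isOpen_ball.mem_nhds (by simpa using hs))).differentiableWithinAt

theorem hasSum_taylorCoeff_slice {K : ℝ} (hK : 0 < K) {f : ℂ × ℂ → ℂ}
    (hf : DifferentiableOn ℂ f (cartanHartogsY K)) {p : ℂ × ℂ} (hp : p ∈ cartanHartogsY K) :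
    HasSum (fun j => taylorCoeff (fun W => f (W, p.2)) j * p.1 ^ j) (f p) :=
  have h := (cartanHartogsY_mem_iff hK).1 hp
  hasSum_taylorCoeff (differentiableOn_slice hK hf h.1) h.2

theorem hasSum_taylorCoeff₂ {K : ℝ} (hK : 0 < K) {f : ℂ × ℂ → ℂ}
    (hf : DifferentiableOn ℂ f (cartanHartogsY K)) {Z : ℂ} (hZ : ‖Z‖ < 1) (j : ℕ) :
    HasSum (fun m => taylorCoeff₂ f j m * Z ^ m) (taylorCoeff (fun W => f (W, Z)) j) :=
  hasSum_taylorCoeff (differentiableOn_taylorCoeff_slice hK hf j) hZ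

/-! ### Orthogonality of monomials by rotation averaging -/

/-- Averaging an integrable function over a family of measure-preserving maps. -/
theorem integral_average {X : Type*} [MeasurableSpace X] {μ : Measure X} [SFinite μ]
    {Φ : ℝ → X → X} (hΦ : Measurable (Function.uncurry Φ))
    (hμ : ∀ θ, MeasurePreserving (Φ θ) μ μ) {F : X → ℂ} (hFm : StronglyMeasurable F)
    (hF : Integrable F μ) :
    StronglyMeasurable (fun x => ∫ θ in (0 : ℝ)..2 * Real.pi, F (Φ θ x)) ∧
    Integrable (fun x => ∫ θ in (0 : ℝ)..2 * Real.pi, F (Φ θ x)) μ ∧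
    ∫ x, (∫ θ in (0 : ℝ)..2 * Real.pi, F (Φ θ x)) ∂μ = 2 * Real.pi * ∫ x, F x ∂μ := by
  have hpi : (0 : ℝ) ≤ 2 * Real.pi := by positivity
  simp_rw [intervalIntegral.integral_of_le hpi]
  set ν : Measure ℝ := volume.restrict (Set.Ioc 0 (2 * Real.pi)) with hν
  have hm : StronglyMeasurable (fun q : ℝ × X => F (Φ q.1 q.2)) := hFm.comp_measurable hΦ
  have hi : Integrable (fun q : ℝ × X => F (Φ q.1 q.2)) (ν.prod μ) := by
    rw [integrable_prod_iff hm.aestronglyMeasurable]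
    refine ⟨Filter.Eventually.of_forall fun θ => (hμ θ).integrable_comp_of_integrable hF, ?_⟩
    have e : ∀ θ, ∫ x, ‖F (Φ θ x)‖ ∂μ = ∫ x, ‖F x‖ ∂μ := fun θ => by
      conv_rhs => rw [← (hμ θ).map_eq, integral_map (hμ θ).measurable.aemeasurable
        (by rw [(hμ θ).map_eq]; exact hF.1.norm)]
    simp_rw [e]
    exact integrable_const _
  refine ⟨hm.integral_prod_left', hi.integral_prod_right, ?_⟩
  rw [← integral_integral_swap hi]
  have e : ∀ θ, ∫ x, F (Φ θ x) ∂μ = ∫ x, F x ∂μ := fun θ => by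
    conv_rhs => rw [← (hμ θ).map_eq, integral_map (hμ θ).measurable.aemeasurable
        (by rw [(hμ θ).map_eq]; exact hF.1)]
  simp_rw [e]
  rw [integral_const, hν]
  simp [hpi]

theorem measurePreserving_exp_mul (θ : ℝ) :
    MeasurePreserving (fun z : ℂ => Complex.exp (θ * Complex.I) * z) := by
  have h := (rotation (Circle.exp θ)).measurePreserving
  convert! h using 2

/-- Pairing with a monomial extracts a Taylor coefficient. -/
theorem setIntegral_mul_conj_monomial {K : ℝ} (hK : 0 < K) {f : ℂ × ℂ → ℂ}
    (hf : DifferentiableOn ℂ f (cartanHartogsY K)) (hfi : IntegrableOn f (cartanHartogsY K))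
    (j m : ℕ) :
    ∫ p in cartanHartogsY K, f p * conj (p.1 ^ j * p.2 ^ m) =
      taylorCoeff₂ f j m * ∫ p in cartanHartogsY K, ((‖p.1‖ ^ (2 * j) * ‖p.2‖ ^ (2 * m) : ℝ) : ℂ) := by
  set D := cartanHartogsY K with hD
  have hDm : MeasurableSet D := (isOpen_cartanHartogsY hK).measurableSet
  have hnorm : ∀ (θ : ℝ) (z : ℂ), ‖Complex.exp (θ * Complex.I) * z‖ = ‖z‖ := fun θ z => by
    rw [norm_mul, Complex.norm_exp_ofReal_mul_I, one_mul]
  have hconj : ∀ (θ : ℝ) (n : ℕ), conj (Complex.exp (θ * Complex.I) ^ n) =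
      Complex.exp (-(n * (θ * Complex.I))) := fun θ n => by
    rw [← Complex.exp_nat_mul, ← Complex.exp_conj]
    simp
  -- Values of `f` off `D` are arbitrary. Cutting off makes the integrand genuinely measurable on
  -- the whole space, and `D` is rotation invariant.
  set F : ℂ × ℂ → ℂ := D.indicator fun p => f p * conj (p.1 ^ j * p.2 ^ m) with hF
  have hFc : ContinuousOn (fun p : ℂ × ℂ => f p * conj (p.1 ^ j * p.2 ^ m)) D :=
    hf.continuousOn.mul (Continuous.continuousOn (by fun_prop))
  have hFm : StronglyMeasurable F := by
    have : Measurable F := by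
      classical
      rw [hF, ← Set.piecewise_eq_indicator]
      exact hFc.measurable_piecewise continuousOn_const hDm
    exact this.stronglyMeasurable
  have hFi : Integrable F := by
    rw [hF, integrable_indicator_iff hDm]
    refine Integrable.mono hfi (hFc.aestronglyMeasurable hDm) ?_
    filter_upwards [ae_restrict_mem hDm] with p hp
    rw [norm_mul, RCLike.norm_conj, norm_mul, norm_pow, norm_pow]
    refine mul_le_of_le_one_right (norm_nonneg _) (mul_le_one₀ ?_ (by positivity) ?_)
    · exact pow_le_one₀ (norm_nonneg _) (cartanHartogsY_norm_fst_lt_one hK hp).le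
    · exact pow_le_one₀ (norm_nonneg _) (cartanHartogsY_norm_snd_lt_one hp).le
  obtain ⟨hm1, hi1, he1⟩ := integral_average (μ := (volume : Measure (ℂ × ℂ)))
    (Φ := fun θ p => (Complex.exp (θ * Complex.I) * p.1, p.2)) (by fun_prop)
    (fun θ => (measurePreserving_exp_mul θ).prod (MeasurePreserving.id _)) hFm hFi
  -- The second average is applied to the result of the first, hence the need for its measurability
  -- and integrability.
  obtain ⟨-, -, he2⟩ := integral_average (μ := (volume : Measure (ℂ × ℂ)))
    (Φ := fun θ p => (p.1, Complex.exp (θ * Complex.I) * p.2)) (by fun_prop)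
    (fun θ => (MeasurePreserving.id _).prod (measurePreserving_exp_mul θ)) hm1 hi1
  have hmemW : ∀ (θ : ℝ) (p : ℂ × ℂ), (Complex.exp (θ * Complex.I) * p.1, p.2) ∈ D ↔ p ∈ D :=
    fun θ p => by simp only [hD, cartanHartogsY, Set.mem_ofPred_eq, hnorm]
  have hmemZ : ∀ (θ : ℝ) (p : ℂ × ℂ), (p.1, Complex.exp (θ * Complex.I) * p.2) ∈ D ↔ p ∈ D :=
    fun θ p => by simp only [hD, cartanHartogsY, Set.mem_ofPred_eq, hnorm]
  have e1 : ∀ p : ℂ × ℂ,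
      ∫ θ in (0 : ℝ)..2 * Real.pi, F (Complex.exp (θ * Complex.I) * p.1, p.2) =
      D.indicator (fun p => 2 * Real.pi * (taylorCoeff (fun W => f (W, p.2)) j * p.1 ^ j) *
        conj (p.1 ^ j * p.2 ^ m)) p := by
    intro p
    by_cases hp : p ∈ D
    · have h := (cartanHartogsY_mem_iff hK).1 hp
      rw [Set.indicator_of_mem hp, ← integral_circle_taylorCoeff (differentiableOn_slice hK hf h.1)
        h.2 j, ← intervalIntegral.integral_mul_const]
      refine intervalIntegral.integral_congr fun θ _ => ?_
      simp only [hF]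
      rw [Set.indicator_of_mem ((hmemW θ p).2 hp), mul_pow, mul_assoc (_ ^ j), map_mul, hconj]
      ring
    · rw [Set.indicator_of_notMem hp]
      have : ∀ θ : ℝ, F (Complex.exp (θ * Complex.I) * p.1, p.2) = 0 := fun θ =>
        Set.indicator_of_notMem (fun h => hp ((hmemW θ p).1 h)) _
      simp [this]
  have e2 : ∀ p : ℂ × ℂ,
      ∫ φ in (0 : ℝ)..2 * Real.pi, ∫ θ in (0 : ℝ)..2 * Real.pi,
        F (Complex.exp (θ * Complex.I) * p.1, Complex.exp (φ * Complex.I) * p.2) =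
      (2 * Real.pi) ^ 2 * taylorCoeff₂ f j m *
        D.indicator (fun p => ((‖p.1‖ ^ (2 * j) * ‖p.2‖ ^ (2 * m) : ℝ) : ℂ)) p := by
    intro p
    have e3 : ∀ φ : ℝ, ∫ θ in (0 : ℝ)..2 * Real.pi,
        F (Complex.exp (θ * Complex.I) * p.1, Complex.exp (φ * Complex.I) * p.2) = _ :=
      fun φ => e1 (p.1, Complex.exp (φ * Complex.I) * p.2)
    simp_rw [e3]
    by_cases hp : p ∈ D
    · have h := (cartanHartogsY_mem_iff hK).1 hp
      have h2 := integral_circle_taylorCoeff (differentiableOn_taylorCoeff_slice hK hf j) h.1 m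
      have e4 : (2 * Real.pi) ^ 2 * taylorCoeff₂ f j m *
          D.indicator (fun p => ((‖p.1‖ ^ (2 * j) * ‖p.2‖ ^ (2 * m) : ℝ) : ℂ)) p =
          2 * Real.pi * (p.1 ^ j * conj (p.1 ^ j) * conj (p.2 ^ m)) *
            (2 * Real.pi * (taylorCoeff₂ f j m * p.2 ^ m)) := by
        rw [Set.indicator_of_mem hp, pow_mul', pow_mul', ← norm_pow p.1, ← norm_pow p.2, Complex.ofReal_mul,
          ← Complex.normSq_eq_norm_sq, ← Complex.normSq_eq_norm_sq, ← Complex.mul_conj,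
          ← Complex.mul_conj]
        ring
      rw [e4, taylorCoeff₂, ← h2, ← intervalIntegral.integral_const_mul]
      refine intervalIntegral.integral_congr fun φ _ => ?_
      rw [Set.indicator_of_mem ((hmemZ φ p).2 hp), mul_pow, map_mul, map_mul, hconj]
      ring
    · rw [Set.indicator_of_notMem hp, mul_zero]
      have : ∀ (φ : ℝ) (G : ℂ × ℂ → ℂ),
          D.indicator G (p.1, Complex.exp (φ * Complex.I) * p.2) = 0 := fun φ G =>
        Set.indicator_of_notMem (fun h => hp ((hmemZ φ p).1 h)) _
      simp only [this, intervalIntegral.integral_zero]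
  simp_rw [e2] at he2
  rw [he1, integral_const_mul, integral_indicator hDm, hF, integral_indicator hDm] at he2
  have hpi : (2 * Real.pi : ℂ) ≠ 0 := by simp [Real.pi_ne_zero]
  have : (2 * Real.pi : ℂ) ^ 2 ≠ 0 := pow_ne_zero _ hpi
  apply mul_left_cancel₀ this
  rw [← mul_assoc, he2]
  ring

/-! ### Norms of monomials -/

theorem integral_radial_ball (g : ℝ → ℝ) {ρ : ℝ} (hρ : 0 ≤ ρ) :
    ∫ z : ℂ, (if ‖z‖ < ρ then g ‖z‖ else 0) = 2 * Real.pi * ∫ r in (0 : ℝ)..ρ, r * g r := by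
  have h := integral_fun_norm_addHaar (volume : Measure ℂ) (fun r => if r < ρ then g r else 0)
  rw [h, Complex.finrank_real_complex, measureReal_def, Complex.volume_ball,
    intervalIntegral.integral_of_le hρ, integral_Ioc_eq_integral_Ioo]
  have e : ∫ y in Set.Ioi (0 : ℝ), y ^ (2 - 1) • (if y < ρ then g y else 0) =
      ∫ y in Set.Ioo 0 ρ, y * g y := by
    have : ∀ y : ℝ, y ^ (2 - 1) • (if y < ρ then g y else 0) =
        (Set.Iio ρ).indicator (fun y => y * g y) y := fun y => by
      by_cases hy : y < ρ <;> simp [hy]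
    simp_rw [this]
    rw [setIntegral_indicator measurableSet_Iio]
    rfl
  rw [e]
  simp
  ring

theorem succ_mul_multichoose_succ (b : ℝ) (n : ℕ) :
    (n + 1) * Ring.multichoose b (n + 1) = Ring.multichoose b n * (b + n) := by
  have h1 := Ring.factorial_nsmul_multichoose_eq_ascPochhammer b (n + 1)
  have h0 := Ring.factorial_nsmul_multichoose_eq_ascPochhammer b n
  rw [Polynomial.ascPochhammer_smeval_eq_eval] at h0 h1
  rw [ascPochhammer_succ_eval, ← h0, nsmul_eq_mul, nsmul_eq_mul, Nat.factorial_succ] at h1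
  have hf : ((n.factorial : ℕ) : ℝ) ≠ 0 := by positivity
  apply mul_left_cancel₀ hf
  push_cast at h1 ⊢
  linarith

theorem multichoose_pos {b : ℝ} (hb : 0 < b) (n : ℕ) : 0 < Ring.multichoose b n := by
  induction n with
  | zero => simp
  | succ n ih =>
    have h2 : 0 < Ring.multichoose b n * (b + n) := by positivity
    rw [← succ_mul_multichoose_succ] at h2
    exact pos_of_mul_pos_right h2 (by positivity)

/-- A Beta integral. Since `r ^ (2 * m + 2) * (1 - r ^ 2) ^ (a + 1)` vanishes at both ends,
integrating its derivative multiplies the integral by `(m + 1) / (a + m + 2)` when `m` increases by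
one, which is the inverse of the recursion in `succ_mul_multichoose_succ`. -/
theorem integral_pow_mul_one_sub_sq_rpow {a : ℝ} (ha : 0 < a) (m : ℕ) :
    ∫ r in (0 : ℝ)..1, r ^ (2 * m + 1) * (1 - r ^ 2) ^ a =
      (2 * (a + 1) * Ring.multichoose (a + 2) m)⁻¹ := by
  have hderiv : ∀ (b : ℝ), 0 < b → ∀ r : ℝ, HasDerivAt (fun r : ℝ => (1 - r ^ 2) ^ (b + 1))
      (-(2 * (b + 1) * r * (1 - r ^ 2) ^ b)) r := fun b hb r => by
    have h1 : HasDerivAt (fun r : ℝ => 1 - r ^ 2) (-(2 * r)) r := by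
      simpa using (hasDerivAt_pow 2 r).const_sub 1
    have := h1.rpow_const (p := b + 1) (Or.inr (by linarith))
    convert! this using 1
    rw [add_sub_cancel_right]
    ring
  have hcont : ∀ b : ℝ, 0 ≤ b → Continuous fun r : ℝ => (1 - r ^ 2) ^ b := fun b hb =>
    (by fun_prop : Continuous fun r : ℝ => 1 - r ^ 2).rpow_const fun _ => Or.inr hb
  induction m with
  | zero =>
    have h := intervalIntegral.integral_eq_sub_of_hasDerivAt (a := 0) (b := 1)
      (fun r _ => (hderiv a ha r).const_mul (-(2 * (a + 1))⁻¹))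
      (Continuous.intervalIntegrable (by
        have := hcont a ha.le
        fun_prop) _ _)
    have e : ∀ r : ℝ, -(2 * (a + 1))⁻¹ * -(2 * (a + 1) * r * (1 - r ^ 2) ^ a) =
        r ^ (2 * 0 + 1) * (1 - r ^ 2) ^ a := fun r => by field_simp; ring
    simp_rw [e] at h
    rw [h]
    have : (a + 1) ≠ 0 := by positivity
    simp [Real.zero_rpow this]
  | succ m ih =>
    have h := intervalIntegral.integral_eq_sub_of_hasDerivAt (a := 0) (b := 1)
      (fun r _ => (hasDerivAt_pow (2 * m + 2) r).mul (hderiv a ha r))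
      (Continuous.intervalIntegrable (by
        have := hcont a ha.le
        have := hcont (a + 1) (by linarith)
        fun_prop) _ _)
    have e : ∀ r ∈ Set.uIcc (0 : ℝ) 1, ((2 * m + 2 : ℕ) : ℝ) * r ^ (2 * m + 2 - 1) * (1 - r ^ 2) ^ (a + 1) +
        r ^ (2 * m + 2) * -(2 * (a + 1) * r * (1 - r ^ 2) ^ a) =
        2 * (m + 1) * (r ^ (2 * m + 1) * (1 - r ^ 2) ^ a) -
          2 * (a + m + 2) * (r ^ (2 * (m + 1) + 1) * (1 - r ^ 2) ^ a) := fun r hr => by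
      rw [Set.uIcc_of_le zero_le_one] at hr
      -- The base vanishes at `r = 1`, so the splitting relies on the exponent `a + 1` being
      -- nonzero.
      rw [Real.rpow_add_one' (by nlinarith [hr.1, hr.2]) (by positivity)]
      rw [show 2 * m + 2 - 1 = 2 * m + 1 by omega]
      push_cast
      ring
    rw [intervalIntegral.integral_congr e, intervalIntegral.integral_sub,
      intervalIntegral.integral_const_mul, intervalIntegral.integral_const_mul, ih] at h
    · have : a + 1 ≠ 0 := by positivity
      simp only [one_pow, sub_self, Real.zero_rpow this, Pi.mul_apply] at h
      have h3 := multichoose_pos (by positivity : 0 < a + 2) m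
      have h4 := multichoose_pos (by positivity : 0 < a + 2) (m + 1)
      have h5 := succ_mul_multichoose_succ (a + 2) m
      apply eq_inv_of_mul_eq_one_left
      have h6 : (0 : ℝ) < a + m + 2 := by positivity
      have h7 : ∫ r in (0 : ℝ)..1, r ^ (2 * (m + 1) + 1) * (1 - r ^ 2) ^ a =
          (m + 1) * (2 * (a + 1) * Ring.multichoose (a + 2) m)⁻¹ / (a + m + 2) := by
        rw [eq_div_iff h6.ne']
        simp only [mul_inv] at h ⊢
        simp at h
        linarith
      rw [h7]
      field_simp
      linarith
    · exact Continuous.intervalIntegrable (by have := hcont a ha.le; fun_prop) _ _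
    · exact Continuous.intervalIntegrable (by have := hcont a ha.le; fun_prop) _ _

/-- The reciprocal of the squared norm of the monomial `W ^ j * Z ^ m` in `A²(cartanHartogsY K)`. -/
noncomputable def cartanHartogsCoeff (K : ℝ) (j m : ℕ) : ℝ :=
  (j + 1) * ((j + 1) / K + 1) * Ring.multichoose ((j + 1) / K + 2) m / Real.pi ^ 2

theorem setIntegral_monomial_norm_sq {K : ℝ} (hK : 0 < K) (j m : ℕ) :
    ∫ p in cartanHartogsY K, ‖p.1‖ ^ (2 * j) * ‖p.2‖ ^ (2 * m) = (cartanHartogsCoeff K j m)⁻¹ := by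
  have hDm : MeasurableSet (cartanHartogsY K) := (isOpen_cartanHartogsY hK).measurableSet
  have hi : IntegrableOn (fun p : ℂ × ℂ => ‖p.1‖ ^ (2 * j) * ‖p.2‖ ^ (2 * m)) (cartanHartogsY K) := by
    have hc : IsCompact (closure (cartanHartogsY K)) := (isBounded_cartanHartogsY hK).isCompact_closure
    exact (ContinuousOn.integrableOn_compact hc
      (Continuous.continuousOn (by fun_prop))).mono_set subset_closure
  rw [← integral_indicator hDm]
  have hi' := (integrable_indicator_iff hDm).2 hi
  rw [Measure.volume_eq_prod] at hi' ⊢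
  rw [integral_prod_symm _ hi']
  -- The slice over `Z` is a disc of radius `(1 - ‖Z‖ ^ 2) ^ (1 / (2 * K))`, on which `‖W‖ ^ (2 *
  -- j)` integrates to `π / (j + 1)` times the radius to the power `2 * j + 2`.
  have e : ∀ Z : ℂ, ∫ W : ℂ, (cartanHartogsY K).indicator
      (fun p : ℂ × ℂ => ‖p.1‖ ^ (2 * j) * ‖p.2‖ ^ (2 * m)) (W, Z) =
      if ‖Z‖ < 1 then ‖Z‖ ^ (2 * m) * (Real.pi / (j + 1) * (1 - ‖Z‖ ^ 2) ^ ((j + 1) / K)) else 0 := by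
    intro Z
    split_ifs with hZ
    · have hZ' : 0 ≤ 1 - ‖Z‖ ^ 2 := by nlinarith [norm_nonneg Z]
      have e1 : ∀ W : ℂ, (cartanHartogsY K).indicator
          (fun p : ℂ × ℂ => ‖p.1‖ ^ (2 * j) * ‖p.2‖ ^ (2 * m)) (W, Z) = ‖Z‖ ^ (2 * m) *
          (if ‖W‖ < (1 - ‖Z‖ ^ 2) ^ (2 * K)⁻¹ then ‖W‖ ^ (2 * j) else 0) := by
        intro W
        have h := cartanHartogsY_mem_iff hK (p := (W, Z))
        by_cases hW : ‖W‖ < (1 - ‖Z‖ ^ 2) ^ (2 * K)⁻¹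
        · rw [Set.indicator_of_mem (h.2 ⟨hZ, hW⟩), if_pos hW, mul_comm]
        · rw [Set.indicator_of_notMem fun hp => hW (h.1 hp).2, if_neg hW, mul_zero]
      simp_rw [e1]
      rw [integral_const_mul, integral_radial_ball (fun r => r ^ (2 * j)) (by positivity)]
      simp_rw [← pow_succ']
      rw [integral_pow, ← Real.rpow_natCast (_ ^ _), ← Real.rpow_mul hZ']
      have e2 : (2 * K)⁻¹ * ((2 * j + 1 + 1 : ℕ) : ℝ) = (j + 1) / K := by
        push_cast; field_simp; ring
      rw [e2]
      push_cast
      rw [zero_pow (by omega)]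
      field_simp
      ring
    · have : ∀ W : ℂ, (cartanHartogsY K).indicator
          (fun p : ℂ × ℂ => ‖p.1‖ ^ (2 * j) * ‖p.2‖ ^ (2 * m)) (W, Z) = 0 := fun W =>
        Set.indicator_of_notMem (fun h => hZ (cartanHartogsY_norm_snd_lt_one h)) _
      simp [this]
  simp_rw [e]
  rw [integral_radial_ball (fun r => r ^ (2 * m) * (Real.pi / (j + 1) * (1 - r ^ 2) ^ ((j + 1) / K)))
    zero_le_one]
  have e3 : ∀ r : ℝ, r * (r ^ (2 * m) * (Real.pi / (j + 1) * (1 - r ^ 2) ^ ((j + 1) / K))) =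
      Real.pi / (j + 1) * (r ^ (2 * m + 1) * (1 - r ^ 2) ^ ((j + 1) / K)) := fun r => by ring
  simp_rw [e3]
  rw [intervalIntegral.integral_const_mul, integral_pow_mul_one_sub_sq_rpow (by positivity),
    cartanHartogsCoeff]
  simp only [mul_inv, div_eq_mul_inv, inv_inv]
  ring

/-! ### Summation of the kernel series -/

/-- The Bergman kernel of `cartanHartogsY K` as a function of `x = W * conj W'` and
`y = Z * conj Z'`. -/
noncomputable def cartanHartogsSum (K : ℝ) (x y : ℂ) : ℂ :=
  ((1 - y) ^ ((K⁻¹ + 2 : ℝ) : ℂ))⁻¹ / Real.pi ^ 2 *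
    (2 * K⁻¹ / (1 - x / (1 - y) ^ ((K⁻¹ : ℝ) : ℂ)) ^ 3 +
      (1 - K⁻¹) / (1 - x / (1 - y) ^ ((K⁻¹ : ℝ) : ℂ)) ^ 2)

theorem hasSum_multichoose_mul_pow (a : ℝ) {y : ℂ} (hy : ‖y‖ < 1) :
    HasSum (fun m => ((Ring.multichoose a m : ℝ) : ℂ) * y ^ m) (1 / (1 - y) ^ (a : ℂ)) := by
  have h := (Complex.one_div_one_sub_cpow_hasFPowerSeriesOnBall_zero (a : ℂ)).hasSum (y := y)
    (by
      rw [Metric.mem_eball, edist_zero_right, ← ofReal_norm]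
      exact ENNReal.ofReal_lt_one.2 hy)
  rw [zero_add] at h
  refine h.congr_fun fun m => ?_
  rw [Ring.multichoose_eq, Complex.ofReal_choose]
  simp [mul_comm]

theorem norm_div_cpow_lt_one {K : ℝ} {x y : ℂ} (hx : ‖x‖ < ‖1 - y‖ ^ K⁻¹) :
    ‖x / (1 - y) ^ ((K⁻¹ : ℝ) : ℂ)‖ < 1 := by
  rw [norm_div, Complex.norm_cpow_real]
  exact (div_lt_one ((norm_nonneg _).trans_lt hx)).2 hx

/-- The exponent `(j + 1) / K + 2` is affine in `j`, so the binomial sum over `m` leaves a fixed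
power of `1 - y` times a `j`-th power; this is where the variable `t` comes from. -/
theorem hasSum_cartanHartogsCoeff_right (K : ℝ) {x y : ℂ} (hy : ‖y‖ < 1) (j : ℕ) :
    HasSum (fun m => (cartanHartogsCoeff K j m : ℂ) * (x ^ j * y ^ m))
      (((1 - y) ^ ((K⁻¹ + 2 : ℝ) : ℂ))⁻¹ / Real.pi ^ 2 *
        ((j + 1) * ((j + 1) / K + 1) * (x / (1 - y) ^ ((K⁻¹ : ℝ) : ℂ)) ^ j)) := by
  have h1y : (1 - y) ≠ 0 := fun h => by
    rw [sub_eq_zero] at h; simp [← h] at hy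
  have h := (hasSum_multichoose_mul_pow ((j + 1) / K + 2) hy).mul_left
    ((j + 1) * ((j + 1) / K + 1) / Real.pi ^ 2 * x ^ j : ℂ)
  have e : (1 - y) ^ (((j + 1) / K + 2 : ℝ) : ℂ) =
      (1 - y) ^ ((K⁻¹ + 2 : ℝ) : ℂ) * ((1 - y) ^ ((K⁻¹ : ℝ) : ℂ)) ^ j := by
    rw [← Complex.cpow_nat_mul, ← Complex.cpow_add _ _ h1y]
    congr 1
    push_cast
    field_simp
    ring
  rw [e] at h
  convert! h using 1
  · funext m
    rw [cartanHartogsCoeff]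
    push_cast
    ring
  · rw [div_pow]
    simp only [div_eq_mul_inv, mul_inv, one_mul]
    ring

/-- Rests on `(j + 1) * ((j + 1) / K + 1) = (2 / K) * choose (j + 2) 2 + (1 - 1 / K) * (j + 1)`. -/
theorem hasSum_cartanHartogsCoeff_left {K : ℝ} {t c : ℂ} (ht : ‖t‖ < 1) :
    HasSum (fun j : ℕ => c * ((j + 1) * ((j + 1) / K + 1) * t ^ j))
      (c * (2 * K⁻¹ / (1 - t) ^ 3 + (1 - K⁻¹) / (1 - t) ^ 2)) := by
  have h2 := (hasSum_choose_mul_geometric_of_norm_lt_one 2 ht).mul_left (2 * (K : ℂ)⁻¹)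
  have h1 := (hasSum_choose_mul_geometric_of_norm_lt_one 1 ht).mul_left (1 - (K : ℂ)⁻¹)
  convert! (h2.add h1).mul_left c using 1
  · funext j
    rw [Nat.choose_one_right, Nat.cast_choose_two]
    push_cast
    ring
  · push_cast
    ring

theorem cartanHartogsCoeff_pos {K : ℝ} (hK : 0 < K) (j m : ℕ) : 0 < cartanHartogsCoeff K j m := by
  have := multichoose_pos (by positivity : 0 < ((j : ℝ) + 1) / K + 2) m
  unfold cartanHartogsCoeff
  positivity

theorem one_sub_norm_rpow_le {K : ℝ} (hK : 0 < K) {y : ℂ} (hy : ‖y‖ < 1) :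
    (1 - ‖y‖) ^ K⁻¹ ≤ ‖1 - y‖ ^ K⁻¹ := by
  refine Real.rpow_le_rpow (by linarith) ?_ (by positivity)
  simpa using norm_sub_norm_le 1 y

/-- Positive coefficients turn the norms into the same series at `(‖x‖, ‖y‖)`, where iterated sums
suffice. This is why the bound on `x` involves `1 - ‖y‖` instead of `‖1 - y‖`. -/
theorem summable_norm_cartanHartogsCoeff {K : ℝ} (hK : 0 < K) {x y : ℂ} (hy : ‖y‖ < 1)
    (hx : ‖x‖ < (1 - ‖y‖) ^ K⁻¹) : Summable (fun i : ℕ × ℕ =>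
      ‖(cartanHartogsCoeff K i.1 i.2 : ℂ) * (x ^ i.1 * y ^ i.2)‖) := by
  have e : ∀ j m, ‖(cartanHartogsCoeff K j m : ℂ) * (x ^ j * y ^ m)‖ =
      ((cartanHartogsCoeff K j m : ℂ) * ((‖x‖ : ℂ) ^ j * (‖y‖ : ℂ) ^ m)).re := fun j m => by
    rw [norm_mul, norm_mul, norm_pow, norm_pow, Complex.norm_real,
      Real.norm_of_nonneg (cartanHartogsCoeff_pos hK j m).le]
    norm_cast
  have hy' : ‖(‖y‖ : ℂ)‖ < 1 := by simpa using hy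
  have hx' : ‖(‖x‖ : ℂ)‖ < ‖1 - (‖y‖ : ℂ)‖ ^ K⁻¹ :=
    lt_of_lt_of_le (by simpa using hx) (one_sub_norm_rpow_le hK hy')
  have h1 := fun j => Complex.hasSum_re
    (hasSum_cartanHartogsCoeff_right K (x := (‖x‖ : ℂ)) (y := (‖y‖ : ℂ)) hy' j)
  rw [summable_prod_of_nonneg fun i => norm_nonneg _]
  simp_rw [e]
  refine ⟨fun j => (h1 j).summable, ?_⟩
  simp_rw [fun j => (h1 j).tsum_eq]
  exact (Complex.hasSum_re (hasSum_cartanHartogsCoeff_left (norm_div_cpow_lt_one hx'))).summable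

theorem hasSum_cartanHartogsSum {K : ℝ} (hK : 0 < K) {x y : ℂ} (hy : ‖y‖ < 1)
    (hx : ‖x‖ < (1 - ‖y‖) ^ K⁻¹) :
    HasSum (fun i : ℕ × ℕ => (cartanHartogsCoeff K i.1 i.2 : ℂ) * (x ^ i.1 * y ^ i.2))
      (cartanHartogsSum K x y) := by
  have h := (summable_norm_cartanHartogsCoeff hK hy hx).of_norm.hasSum
  have h3 := h.prod_fiberwise (fun j => hasSum_cartanHartogsCoeff_right K hy j)
  have h4 := hasSum_cartanHartogsCoeff_left (K := K)
    (c := ((1 - y) ^ ((K⁻¹ + 2 : ℝ) : ℂ))⁻¹ / Real.pi ^ 2)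
    (norm_div_cpow_lt_one (hx.trans_le (one_sub_norm_rpow_le hK hy)))
  rw [h3.unique h4] at h
  exact h

/-! ### Absence of zeros and uniform bounds -/

theorem cartanHartogsSum_ne_zero {K : ℝ} (hK : 0 < K) {x y : ℂ} (hy : ‖y‖ < 1)
    (hx : ‖x‖ < ‖1 - y‖ ^ K⁻¹) : cartanHartogsSum K x y ≠ 0 := by
  have ht := norm_div_cpow_lt_one hx
  unfold cartanHartogsSum
  set t := x / (1 - y) ^ ((K⁻¹ : ℝ) : ℂ)
  have h1y : (1 - y) ≠ 0 := fun h => by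
    rw [sub_eq_zero] at h; simp [← h] at hy
  have h1t : (1 - t) ≠ 0 := fun h => by
    rw [sub_eq_zero] at h; simp [← h] at ht
  refine mul_ne_zero (div_ne_zero (inv_ne_zero ?_) (by simp [Real.pi_ne_zero])) ?_
  · rw [Complex.cpow_ne_zero_iff]
    exact Or.inl h1y
  · have e : 2 * ((K⁻¹ : ℝ) : ℂ) / (1 - t) ^ 3 + (1 - ((K⁻¹ : ℝ) : ℂ)) / (1 - t) ^ 2 =
        ((1 + ((K⁻¹ : ℝ) : ℂ)) - (1 - ((K⁻¹ : ℝ) : ℂ)) * t) / (1 - t) ^ 3 := by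
      field_simp
      ring
    rw [e]
    refine div_ne_zero (fun h => ?_) (pow_ne_zero _ h1t)
    -- A zero of the numerator would force `1 + 1 / K = |1 - 1 / K| * ‖t‖`, which is impossible for
    -- `‖t‖ < 1`.
    have h2 : ‖1 + ((K⁻¹ : ℝ) : ℂ)‖ = ‖1 - ((K⁻¹ : ℝ) : ℂ)‖ * ‖t‖ := by
      rw [← norm_mul, sub_eq_zero.1 h]
    have hk : 0 < K⁻¹ := inv_pos.2 hK
    rw [← Complex.ofReal_one, ← Complex.ofReal_add, ← Complex.ofReal_sub,
      Complex.norm_real, Complex.norm_real, Real.norm_of_nonneg (by linarith)] at h2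
    have h3 : ‖1 - K⁻¹‖ < 1 + K⁻¹ := by
      rw [Real.norm_eq_abs, abs_lt]
      constructor <;> linarith
    nlinarith [norm_nonneg t, norm_nonneg (1 - K⁻¹)]

theorem norm_cartanHartogsSum_le {K : ℝ} (hK : 0 < K) {x y : ℂ} {s τ : ℝ} (hs : s < 1) (hτ : τ < 1)
    (hy : ‖y‖ ≤ s) (hx : ‖x‖ ≤ τ * ‖1 - y‖ ^ K⁻¹) :
    ‖cartanHartogsSum K x y‖ ≤ ((1 - s) ^ (K⁻¹ + 2))⁻¹ / Real.pi ^ 2 *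
      (2 * K⁻¹ / (1 - τ) ^ 3 + (1 + K⁻¹) / (1 - τ) ^ 2) := by
  have h1y : 1 - s ≤ ‖1 - y‖ := by
    have : ‖(1 : ℂ)‖ - ‖y‖ ≤ ‖1 - y‖ := norm_sub_norm_le 1 y
    rw [norm_one] at this
    linarith
  have hs' : 0 < 1 - s := by linarith
  have hτ' : 0 < 1 - τ := by linarith
  have ht : ‖x / (1 - y) ^ ((K⁻¹ : ℝ) : ℂ)‖ ≤ τ := by
    rw [norm_div, Complex.norm_cpow_real]
    exact (div_le_iff₀ (Real.rpow_pos_of_pos (by linarith) _)).2 hx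
  unfold cartanHartogsSum
  set t := x / (1 - y) ^ ((K⁻¹ : ℝ) : ℂ)
  have h1t : 1 - τ ≤ ‖1 - t‖ := by
    have : ‖(1 : ℂ)‖ - ‖t‖ ≤ ‖1 - t‖ := norm_sub_norm_le 1 t
    rw [norm_one] at this
    linarith
  have hk : 0 < K⁻¹ := inv_pos.2 hK
  have hkn : ‖((K⁻¹ : ℝ) : ℂ)‖ = K⁻¹ := by rw [Complex.norm_real, Real.norm_of_nonneg hk.le]
  have hk1 : ‖1 - ((K⁻¹ : ℝ) : ℂ)‖ ≤ 1 + K⁻¹ := by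
    refine (norm_sub_le _ _).trans ?_
    rw [norm_one, hkn]
  rw [norm_mul, norm_div, norm_inv, Complex.norm_cpow_real, norm_pow, Complex.norm_real,
    Real.norm_of_nonneg Real.pi_pos.le]
  refine mul_le_mul ?_ ((norm_add_le _ _).trans (add_le_add ?_ ?_)) (norm_nonneg _) (by positivity)
  · gcongr
  · rw [norm_div, norm_mul, norm_pow, hkn, Complex.norm_ofNat]
    gcongr
  · rw [norm_div, norm_pow]
    gcongr

/-- For a fixed point `w` of the domain, the argument of the kernel stays in a compact subset of
the unit disc. -/
theorem exists_norm_le_mul_rpow {K : ℝ} (hK : 0 < K) {w : ℂ × ℂ} (hw : w ∈ cartanHartogsY K) :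
    ∃ τ, 0 ≤ τ ∧ τ < 1 ∧ ∀ p ∈ cartanHartogsY K,
      ‖p.1‖ * ‖w.1‖ ≤ τ * (1 - ‖p.2‖ * ‖w.2‖) ^ K⁻¹ := by
  have hw2 := cartanHartogsY_norm_snd_lt_one hw
  have hsq : ∀ z : ℂ, ‖z‖ ^ (2 * K) = (‖z‖ ^ K) ^ 2 := fun z => by
    rw [← Real.rpow_natCast, ← Real.rpow_mul (norm_nonneg _), mul_comm]
    norm_num
  have hw' : (‖w.1‖ ^ K) ^ 2 + ‖w.2‖ ^ 2 < 1 := by rw [← hsq]; exact hw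
  have hd : 0 < 1 - ‖w.2‖ ^ 2 := by nlinarith [norm_nonneg w.2]
  set B := ‖w.1‖ ^ K with hB
  -- After raising to the power `K`, the claim is `‖p.1‖ ^ K * B ≤ σ * (1 - ‖p.2‖ * ‖w.2‖)`. As
  -- `‖p.1‖ ^ K < √(1 - ‖p.2‖ ^ 2)`, this choice of `σ` reduces it to the inequality `(1 - r ^ 2) *
  -- (1 - s ^ 2) ≤ (1 - r * s) ^ 2`, whose defect is `(r - s) ^ 2`.
  set σ := B / √(1 - ‖w.2‖ ^ 2) with hσ
  have hB0 : 0 ≤ B := by positivity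
  have hσ0 : 0 ≤ σ := by positivity
  have hσ1 : σ < 1 := by
    rw [hσ, div_lt_one (Real.sqrt_pos.2 hd)]
    exact Real.lt_sqrt_of_sq_lt (by linarith)
  refine ⟨σ ^ K⁻¹, by positivity, Real.rpow_lt_one hσ0 hσ1 (by positivity), fun p hp => ?_⟩
  have hp2 := cartanHartogsY_norm_snd_lt_one hp
  have hp' : (‖p.1‖ ^ K) ^ 2 + ‖p.2‖ ^ 2 < 1 := by rw [← hsq]; exact hp
  have hrs : 0 ≤ 1 - ‖p.2‖ * ‖w.2‖ := by nlinarith [norm_nonneg p.2, norm_nonneg w.2]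
  rw [← Real.mul_rpow hσ0 hrs, Real.le_rpow_inv_iff_of_pos (by positivity) (by positivity) hK,
    Real.mul_rpow (norm_nonneg _) (norm_nonneg _)]
  rw [hσ, div_mul_eq_mul_div, le_div_iff₀ (Real.sqrt_pos.2 hd), ← hB, mul_comm _ B, mul_assoc]
  refine mul_le_mul_of_nonneg_left ?_ hB0
  refine abs_le_of_sq_le_sq' ?_ hrs |>.2
  rw [mul_pow, Real.sq_sqrt hd.le]
  have : (‖p.1‖ ^ K) ^ 2 * (1 - ‖w.2‖ ^ 2) ≤ (1 - ‖p.2‖ ^ 2) * (1 - ‖w.2‖ ^ 2) :=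
    mul_le_mul_of_nonneg_right (by linarith) hd.le
  nlinarith [sq_nonneg (‖p.2‖ - ‖w.2‖)]

theorem norm_snd_mul_lt_one {K : ℝ} {p w : ℂ × ℂ} (hp : p ∈ cartanHartogsY K)
    (hw : w ∈ cartanHartogsY K) : ‖p.2‖ * ‖w.2‖ < 1 := by
  nlinarith [norm_nonneg p.2, norm_nonneg w.2, cartanHartogsY_norm_snd_lt_one hp,
    cartanHartogsY_norm_snd_lt_one hw]

theorem norm_fst_mul_lt_rpow {K : ℝ} (hK : 0 < K) {p w : ℂ × ℂ} (hp : p ∈ cartanHartogsY K)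
    (hw : w ∈ cartanHartogsY K) : ‖p.1‖ * ‖w.1‖ < (1 - ‖p.2‖ * ‖w.2‖) ^ K⁻¹ := by
  obtain ⟨τ, -, hτ, h⟩ := exists_norm_le_mul_rpow hK hw
  refine (h p hp).trans_lt (mul_lt_of_lt_one_left (Real.rpow_pos_of_pos ?_ _) hτ)
  linarith [norm_snd_mul_lt_one hp hw]

/-! ### The explicit kernel and its reproducing property -/

/-- The explicit Bergman kernel of `cartanHartogsY K`. -/
noncomputable def cartanHartogsKernel (K : ℝ) (p w : ℂ × ℂ) : ℂ :=
  cartanHartogsSum K (p.1 * conj w.1) (p.2 * conj w.2)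

theorem cartanHartogsKernel_ne_zero {K : ℝ} (hK : 0 < K) {p w : ℂ × ℂ}
    (hp : p ∈ cartanHartogsY K) (hw : w ∈ cartanHartogsY K) : cartanHartogsKernel K p w ≠ 0 := by
  have hy : ‖p.2 * conj w.2‖ < 1 := by
    rw [norm_mul, RCLike.norm_conj]; exact norm_snd_mul_lt_one hp hw
  refine cartanHartogsSum_ne_zero hK hy (lt_of_lt_of_le ?_ (one_sub_norm_rpow_le hK hy))
  rw [norm_mul, norm_mul, RCLike.norm_conj, RCLike.norm_conj]
  exact norm_fst_mul_lt_rpow hK hp hw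

/-- Only the moduli of `x` and `y` are prescribed, so that one `M` bounds both the kernel and its
series of absolute values. -/
theorem exists_norm_cartanHartogsSum_le {K : ℝ} (hK : 0 < K) {w : ℂ × ℂ}
    (hw : w ∈ cartanHartogsY K) : ∃ M, ∀ p ∈ cartanHartogsY K, ∀ x y : ℂ,
      ‖x‖ = ‖p.1‖ * ‖w.1‖ → ‖y‖ = ‖p.2‖ * ‖w.2‖ → ‖cartanHartogsSum K x y‖ ≤ M := by
  obtain ⟨τ, hτ0, hτ, h⟩ := exists_norm_le_mul_rpow hK hw
  refine ⟨_, fun p hp x y hx hy => norm_cartanHartogsSum_le hK (cartanHartogsY_norm_snd_lt_one hw) hτ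
    ?_ ?_⟩
  · rw [hy]
    exact mul_le_of_le_one_left (norm_nonneg _) (cartanHartogsY_norm_snd_lt_one hp).le
  · rw [hx]
    refine (h p hp).trans (mul_le_mul_of_nonneg_left ?_ hτ0)
    rw [← hy]
    exact one_sub_norm_rpow_le hK (by rw [hy]; exact norm_snd_mul_lt_one hp hw)

theorem differentiableOn_cartanHartogsKernel {K : ℝ} (hK : 0 < K) {w : ℂ × ℂ}
    (hw : w ∈ cartanHartogsY K) :
    DifferentiableOn ℂ (fun p => cartanHartogsKernel K p w) (cartanHartogsY K) := by
  intro p hp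
  apply DifferentiableAt.differentiableWithinAt
  have hy : ‖p.2 * conj w.2‖ < 1 := by
    rw [norm_mul, RCLike.norm_conj]; exact norm_snd_mul_lt_one hp hw
  have hx : ‖p.1 * conj w.1‖ < ‖1 - p.2 * conj w.2‖ ^ K⁻¹ := by
    refine lt_of_lt_of_le ?_ (one_sub_norm_rpow_le hK hy)
    rw [norm_mul, norm_mul, RCLike.norm_conj, RCLike.norm_conj]
    exact norm_fst_mul_lt_rpow hK hp hw
  have hslit : 1 - p.2 * conj w.2 ∈ Complex.slitPlane := by
    rw [sub_eq_add_neg]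
    exact Complex.mem_slitPlane_of_norm_lt_one (by rwa [norm_neg])
  have hne := Complex.slitPlane_ne_zero hslit
  have hcpow : ∀ c : ℝ, DifferentiableAt ℂ (fun q : ℂ × ℂ => (1 - q.2 * conj w.2) ^ (c : ℂ)) p :=
    fun c => DifferentiableAt.cpow (by fun_prop) (by fun_prop) hslit
  have hcne : ∀ c : ℝ, (1 - p.2 * conj w.2) ^ (c : ℂ) ≠ 0 := fun c => by
    rw [Complex.cpow_ne_zero_iff]; exact Or.inl hne
  have ht : 1 - p.1 * conj w.1 / (1 - p.2 * conj w.2) ^ ((K⁻¹ : ℝ) : ℂ) ≠ 0 := fun h => by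
    have := norm_div_cpow_lt_one hx
    rw [← sub_eq_zero.1 h, norm_one] at this
    exact lt_irrefl _ this
  unfold cartanHartogsKernel cartanHartogsSum
  simp only [div_eq_mul_inv] at ht ⊢
  have hd : DifferentiableAt ℂ (fun q : ℂ × ℂ => 1 - q.1 * conj w.1 *
      ((1 - q.2 * conj w.2) ^ ((K⁻¹ : ℝ) : ℂ))⁻¹) p :=
    (differentiableAt_const _).sub (DifferentiableAt.mul (by fun_prop) ((hcpow _).inv (hcne _)))
  have hpow : ∀ n, DifferentiableAt ℂ (fun q : ℂ × ℂ => ((1 - q.1 * conj w.1 *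
      ((1 - q.2 * conj w.2) ^ ((K⁻¹ : ℝ) : ℂ))⁻¹) ^ n)⁻¹) p := fun n =>
    (hd.pow n).inv (pow_ne_zero _ ht)
  exact (((hcpow _).inv (hcne _)).mul_const _).mul
    (((hpow 3).const_mul _).add ((hpow 2).const_mul _))

theorem isBergmanKernel_cartanHartogsKernel {K : ℝ} (hK : 0 < K) :
    IsBergmanKernel (cartanHartogsY K) (cartanHartogsKernel K) := by
  intro w hw
  set D := cartanHartogsY K with hD
  have hDm : MeasurableSet D := (isOpen_cartanHartogsY hK).measurableSet
  obtain ⟨M, hM⟩ := exists_norm_cartanHartogsSum_le hK hw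
  have hdiff := differentiableOn_cartanHartogsKernel hK hw
  have : IsFiniteMeasure ((volume : Measure (ℂ × ℂ)).restrict D) :=
    ⟨by rw [Measure.restrict_apply_univ]; exact (isBounded_cartanHartogsY hK).measure_lt_top⟩
  have hbound : ∀ p ∈ D, ‖cartanHartogsKernel K p w‖ ≤ M := fun p hp =>
    hM p hp _ _ (by rw [norm_mul, RCLike.norm_conj]) (by rw [norm_mul, RCLike.norm_conj])
  refine ⟨⟨hdiff, MemLp.of_bound (hdiff.continuousOn.aestronglyMeasurable hDm) M ?_⟩, ?_⟩
  · filter_upwards [ae_restrict_mem hDm] with p hp using hbound p hp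
  rintro f ⟨hf, hfL⟩
  have hfi : IntegrableOn f D := hfL.integrable (by norm_num)
  set F : ℕ × ℕ → ℂ × ℂ → ℂ := fun i p =>
    f p * conj ((cartanHartogsCoeff K i.1 i.2 : ℂ) *
      ((p.1 * conj w.1) ^ i.1 * (p.2 * conj w.2) ^ i.2)) with hF
  have hFeq : ∀ i p, F i p = cartanHartogsCoeff K i.1 i.2 * (w.1 ^ i.1 * w.2 ^ i.2) *
      (f p * conj (p.1 ^ i.1 * p.2 ^ i.2)) := fun i p => by
    simp only [hF, map_mul, map_pow, Complex.conj_conj, Complex.conj_ofReal, mul_pow]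
    ring
  have hFsum : ∀ p ∈ D, HasSum (fun i => F i p) (f p * conj (cartanHartogsKernel K p w)) := by
    intro p hp
    have h := hasSum_cartanHartogsSum hK (x := p.1 * conj w.1) (y := p.2 * conj w.2)
      (by rw [norm_mul, RCLike.norm_conj]; exact norm_snd_mul_lt_one hp hw)
      (by
        rw [norm_mul, norm_mul, RCLike.norm_conj, RCLike.norm_conj]
        exact norm_fst_mul_lt_rpow hK hp hw)
    exact (Complex.hasSum_conj'.2 h).mul_left (f p)
  have hFint : ∀ i, Integrable (F i) (volume.restrict D) := by
    intro i
    simp_rw [funext (hFeq i)]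
    refine Integrable.const_mul ?_ _
    refine Integrable.mono hfi ((hf.continuousOn.mul
      (Continuous.continuousOn (by fun_prop))).aestronglyMeasurable hDm) ?_
    filter_upwards [ae_restrict_mem hDm] with p hp
    rw [norm_mul, RCLike.norm_conj, norm_mul, norm_pow, norm_pow]
    refine mul_le_of_le_one_right (norm_nonneg _) (mul_le_one₀ ?_ (by positivity) ?_)
    · exact pow_le_one₀ (norm_nonneg _) (cartanHartogsY_norm_fst_lt_one hK hp).le
    · exact pow_le_one₀ (norm_nonneg _) (cartanHartogsY_norm_snd_lt_one hp).le
  -- The integrable majorant `‖f p‖ * M` for all finite partial sums of norms is what permits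
  -- termwise integration.
  have hFnorm : ∀ (u : Finset (ℕ × ℕ)), ∀ p ∈ D, ∑ i ∈ u, ‖F i p‖ ≤ ‖f p‖ * M := by
    intro u p hp
    have e : ∀ i, ‖F i p‖ = ‖f p‖ * ((cartanHartogsCoeff K i.1 i.2 : ℂ) *
        (((‖p.1‖ * ‖w.1‖ : ℝ) : ℂ) ^ i.1 * ((‖p.2‖ * ‖w.2‖ : ℝ) : ℂ) ^ i.2)).re := fun i => by
      simp only [hF]
      rw [norm_mul, RCLike.norm_conj, norm_mul, norm_mul, norm_pow, norm_pow, norm_mul, norm_mul,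
        RCLike.norm_conj, RCLike.norm_conj, Complex.norm_real,
        Real.norm_of_nonneg (cartanHartogsCoeff_pos hK _ _).le]
      norm_cast
    have hn : ∀ a b : ℂ, ‖((‖a‖ * ‖b‖ : ℝ) : ℂ)‖ = ‖a‖ * ‖b‖ := fun a b => by
      rw [Complex.norm_real, Real.norm_of_nonneg (by positivity)]
    have h := Complex.hasSum_re (hasSum_cartanHartogsSum hK
      (x := ((‖p.1‖ * ‖w.1‖ : ℝ) : ℂ)) (y := ((‖p.2‖ * ‖w.2‖ : ℝ) : ℂ))
      (by rw [hn]; exact norm_snd_mul_lt_one hp hw)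
      (by rw [hn, hn]; exact norm_fst_mul_lt_rpow hK hp hw))
    have h2 := h.mul_left ‖f p‖
    simp_rw [← e] at h2
    refine (sum_le_hasSum u (fun i _ => norm_nonneg _) h2).trans ?_
    exact mul_le_mul_of_nonneg_left ((Complex.re_le_norm _).trans (hM p hp _ _ (hn _ _) (hn _ _)))
      (norm_nonneg _)
  have hsum : Summable fun i => ∫ p in D, ‖F i p‖ := by
    refine summable_of_sum_le (c := ∫ p in D, ‖f p‖ * M)
      (fun i => integral_nonneg fun _ => norm_nonneg _) fun u => ?_
    rw [← integral_finsetSum _ fun i _ => (hFint i).norm]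
    refine setIntegral_mono_on (integrable_finsetSum _ fun i _ => (hFint i).norm)
      (hfi.norm.mul_const M) hDm (hFnorm u)
  have h1 := hasSum_integral_of_summable_integral_norm hFint hsum
  have h2 : ∫ p in D, ∑' i, F i p = ∫ p in D, f p * conj (cartanHartogsKernel K p w) :=
    setIntegral_congr_fun hDm fun p hp => (hFsum p hp).tsum_eq
  rw [h2] at h1
  have h3 : ∀ i : ℕ × ℕ, ∫ p in D, F i p = taylorCoeff₂ f i.1 i.2 * w.2 ^ i.2 * w.1 ^ i.1 := by
    intro i
    simp_rw [hFeq i]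
    rw [integral_const_mul, setIntegral_mul_conj_monomial hK hf hfi, integral_complex_ofReal,
      setIntegral_monomial_norm_sq hK]
    have : (cartanHartogsCoeff K i.1 i.2 : ℂ) ≠ 0 :=
      Complex.ofReal_ne_zero.2 (cartanHartogsCoeff_pos hK _ _).ne'
    push_cast
    field_simp
  simp_rw [h3] at h1
  -- Summing over `m` first rebuilds the coefficient of `W ^ j` on the slice through `w`; summing
  -- over `j` then gives `f w`. Absolute convergence of the double Taylor series is never needed as
  -- a separate input.
  have h4 := h1.prod_fiberwise fun j =>
    (hasSum_taylorCoeff₂ hK hf (cartanHartogsY_norm_snd_lt_one hw) j).mul_right (w.1 ^ j)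
  exact (hasSum_taylorCoeff_slice hK hf hw).unique h4

theorem mainTheorem1 (K : ℝ) (hK : 0 < K) :
    (∀ p ∈ cartanHartogsY K, ∀ q ∈ cartanHartogsY K,
      bergmanKernel (cartanHartogsY K) p q ≠ 0) ∧
    IsLuQiKengDomain (cartanHartogsY K) := by
  have hex : ∃ B, IsBergmanKernel (cartanHartogsY K) B :=
    ⟨_, isBergmanKernel_cartanHartogsKernel hK⟩
  have hB : IsBergmanKernel (cartanHartogsY K) (bergmanKernel (cartanHartogsY K)) := by
    rw [bergmanKernel, dif_pos hex]
    exact hex.choose_spec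
  have hne : ∀ p ∈ cartanHartogsY K, ∀ q ∈ cartanHartogsY K,
      bergmanKernel (cartanHartogsY K) p q ≠ 0 := fun p hp q hq => by
    rw [hB.unique (isOpen_cartanHartogsY hK) (isBergmanKernel_cartanHartogsKernel hK) hp hq]
    exact cartanHartogsKernel_ne_zero hK hp hq
  exact ⟨hne, isOpen_cartanHartogsY hK, isConnected_cartanHartogsY hK,
    isBounded_cartanHartogsY hK, hB, hne⟩
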